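/- Let $d\ge 5$ and $n\ge 1$ be integers and let $-\frac{1}{d-1}<\rho<1$. Let $\mu=(\mu_1,\dots,\mu_d)^T$ have the Gaussian law $G_0=N_d(0,\Sigma_d(\rho))$ with compound symmetric covariance matrix $\Sigma_d(\rho)=(1-\rho)I_d+\rho\,1_d1_d^T$, where $1_d$ is the vector of ones, and, given $\mu$, let the observations $Y_{ij}\sim N(\mu_j,1)$, $1\le i\le n$, $1\le j\le d$, be independent. Put $\bar Y_j=n^{-1}\sum_{i=1}^n Y_{ij}$ and $\bar Y=d^{-1}\sum_{j=1}^d\bar Y_j$, and consider the estimators of $\mu$ with coordinates $$\hat\mu_{j,\mathrm{HB}}=\bar Y+\Big[1-\frac{d-3}{n\sum_{k=1}^d(\bar Y_k-\bar Y)^2}\Big](\bar Y_j-\bar Y),\qquad \hat\mu_{j,\mathrm{PHB}}=\Big[1-\frac{d-2}{n\sum_{k=1}^d\bar Y_k^2}\Big]\bar Y_j .$$ For an estimator $\hat\mu$ let $R(\hat\mu,\rho)=\int_{\mathbb R^d}E_{Y\mid\mu}\|\hat\mu-\mu\|_2^2\,dG_0(\mu)$ be its integrated squared-error risk. Then both risks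 are finite and $$R(\hat\mu_{\mathrm{HB}},\rho)=\frac dn-\frac{d-3}{n}\,\frac{1}{1+n(1-\rho)},\qquad R(\hat\mu_{\mathrm{PHB}},\rho)=\frac dn-\frac{(d-2)^2}{2n}\int_0^1\frac{u^{\frac{d-2}{2}-1}}{\sqrt{\xi(u;\rho)}}\,du,$$ where $\xi(u;\rho)=\big[1+n\{1+(d-1)\rho\}(1-u)\big]\big[1+n(1-\rho)(1-u)\big]^{d-1}$ for $u\in[0,1]$. -/

import Mathlib

open MeasureTheory ProbabilityTheory
open scoped Matrix

noncomputable section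

namespace NormalMeans

/-- The compound symmetric correlation matrix `(1 - ρ) I_d + ρ 1_d 1_dᵀ`. -/
def compoundSymm (d : ℕ) (ρ : ℝ) : Matrix (Fin d) (Fin d) ℝ :=
  (1 - ρ) • (1 : Matrix (Fin d) (Fin d) ℝ) +
    ρ • Matrix.vecMulVec (fun _ => (1 : ℝ)) (fun _ => (1 : ℝ))

/-- For `-1/(d-1) < ρ < 1` the compound symmetric matrix is positive definite, so that it is the
covariance matrix of a nondegenerate Gaussian law. -/
theorem compoundSymm_posDef {d : ℕ} (hd : 2 ≤ d) {ρ : ℝ} (h₀ : -1 / ((d : ℝ) - 1) < ρ)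
    (h₁ : ρ < 1) : (compoundSymm d ρ).PosDef := by
  have hd' : (0 : ℝ) < (d : ℝ) - 1 := by
    have : (2 : ℝ) ≤ d := by exact_mod_cast hd
    linarith
  have h₂ : 0 < 1 + ((d : ℝ) - 1) * ρ := by
    rw [div_lt_iff₀ hd'] at h₀
    linarith
  refine Matrix.PosDef.of_dotProduct_mulVec_pos ?_ ?_
  · ext i j
    by_cases h : i = j
    · simp [compoundSymm, Matrix.vecMulVec_apply, h]
    · simp [compoundSymm, Matrix.vecMulVec_apply, Matrix.one_apply, h, Ne.symm h]
  · intro x hx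
    have e : star x ⬝ᵥ (compoundSymm d ρ *ᵥ x) =
        (1 - ρ) * ∑ i, x i ^ 2 + ρ * (∑ i, x i) ^ 2 := by
      rw [compoundSymm, Matrix.add_mulVec, Matrix.smul_mulVec, Matrix.smul_mulVec,
        Matrix.one_mulVec, dotProduct_add, dotProduct_smul, dotProduct_smul,
        Matrix.vecMulVec_mulVec, dotProduct_smul]
      simp [dotProduct, sq]
    have hs : 0 < ∑ i, x i ^ 2 := by
      obtain ⟨i, hi⟩ := Function.ne_iff.mp hx
      exact Finset.sum_pos' (fun i _ => sq_nonneg _)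
        ⟨i, Finset.mem_univ i, by have : x i ≠ 0 := hi
                                  positivity⟩
    have hc : (∑ i, x i) ^ 2 ≤ d * ∑ i, x i ^ 2 := by
      simpa using sq_sum_le_card_mul_sum_sq (s := Finset.univ) (f := x)
    rw [e]
    rcases le_or_gt 0 ρ with h | h
    · have : 0 < (1 - ρ) * ∑ i, x i ^ 2 := mul_pos (by linarith) hs
      nlinarith [mul_nonneg h (sq_nonneg (∑ i, x i))]
    · nlinarith [mul_le_mul_of_nonpos_left hc h.le, mul_pos h₂ hs]

/-- The law of the data `Y = (Y i j)`, `i < n`, `j < d`, given the mean vector `μ`: the `Y i j` are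
independent and `Y i j ∼ N(μ j, 1)`. -/
def dataLaw (n : ℕ) {d : ℕ} (μ : EuclideanSpace ℝ (Fin d)) : Measure (Fin n → Fin d → ℝ) :=
  Measure.pi fun _ : Fin n => Measure.pi fun j : Fin d => gaussianReal (μ j) 1

/-- The sample mean of the `j`-th population. -/
def sampleMean {n d : ℕ} (Y : Fin n → Fin d → ℝ) (j : Fin d) : ℝ :=
  (n : ℝ)⁻¹ * ∑ i, Y i j

/-- The grand mean of the data. -/
def grandMean {n d : ℕ} (Y : Fin n → Fin d → ℝ) : ℝ :=
  (d : ℝ)⁻¹ * ∑ j, sampleMean Y j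

/-- The partial-hierarchical Bayes (James-Stein) estimator. -/
def estPHB {n d : ℕ} (Y : Fin n → Fin d → ℝ) : EuclideanSpace ℝ (Fin d) :=
  WithLp.toLp 2 fun j =>
    (1 - ((d : ℝ) - 2) / ((n : ℝ) * ∑ k, sampleMean Y k ^ 2)) * sampleMean Y j

/-- The hierarchical Bayes estimator. -/
def estHB {n d : ℕ} (Y : Fin n → Fin d → ℝ) : EuclideanSpace ℝ (Fin d) :=
  WithLp.toLp 2 fun j =>
    grandMean Y +
      (1 - ((d : ℝ) - 3) / ((n : ℝ) * ∑ k, (sampleMean Y k - grandMean Y) ^ 2)) *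
        (sampleMean Y j - grandMean Y)

/-- The squared `ℓ²` risk `E_{Y ∣ μ} ‖est Y - μ‖²`, as a value in `[0, ∞]`. -/
def risk {n d : ℕ} (est : (Fin n → Fin d → ℝ) → EuclideanSpace ℝ (Fin d))
    (μ : EuclideanSpace ℝ (Fin d)) : ENNReal :=
  ∫⁻ Y, ENNReal.ofReal (‖est Y - μ‖ ^ 2) ∂(dataLaw n μ)

/-- The integrated squared `ℓ²` risk of an estimator when `μ ∼ G`, as a value in `[0, ∞]`. -/
def integratedRisk {n d : ℕ} (est : (Fin n → Fin d → ℝ) → EuclideanSpace ℝ (Fin d))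
    (G : Measure (EuclideanSpace ℝ (Fin d))) : ENNReal :=
  ∫⁻ μ, risk est μ ∂G

/-- The function `ξ(u; ρ)`. -/
def xi (n d : ℕ) (ρ u : ℝ) : ℝ :=
  (1 + (n : ℝ) * (1 + ((d : ℝ) - 1) * ρ) * (1 - u)) *
    (1 + (n : ℝ) * (1 - ρ) * (1 - u)) ^ (d - 1)

end NormalMeans

end

/-! Only the vector of sample means matters, and it is `μ` plus independent noise with covariance
`n⁻¹ I`. In an orthonormal basis whose vector `b i₀` is proportional to the vector of ones, the
prior has independent coordinates with variances `1 + (d-1)ρ` and `1 - ρ`, while the noise keeps its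
form (`multivariateGaussian_compoundSymm`, `map_dataLaw`). Both estimators are James-Stein rules on
a set `s` of these coordinates: all of them for `estPHB`, all but `i₀` for `estHB` (`estPHB_eq`,
`estHB_eq`). Let `Q` be the sum over `s` of the squared coordinates of the sample mean. Stein's
identity, applied given `μ`, yields the risk `d/n - (|s|-2)²/n² · E[1/Q]`
(`integral_shrinkage_loss`). Writing `1/Q = ∫ exp(-tQ) dt` and using independence turns `E[1/Q]`
into an integral over `t > 0` of a product of factors `(1 + 2t(λ + 1/n))^(-1/2)`
(`lintegral_inv_sum_sq`). With equal variances it has an elementary antiderivative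
(`lintegral_inv_sqrt_pow`); otherwise `t = (n/2)(1/u - 1)` gives the integral with `ξ`
(`lintegral_compoundSymm_eq`). -/

/-! ### Gaussian integrals on the line -/

open scoped NNReal in
theorem integrable_gaussianReal_iff {m : ℝ} {v : ℝ≥0} (hv : v ≠ 0) {f : ℝ → ℝ} :
    Integrable f (gaussianReal m v) ↔ Integrable fun x => gaussianPDFReal m v x * f x := by
  rw [gaussianReal_of_var_ne_zero _ hv, integrable_withDensity_iff_integrable_smul'
    (measurable_gaussianPDF _ _) (ae_of_all _ fun _ => gaussianPDF_lt_top)]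
  simp

open scoped NNReal in
theorem hasDerivAt_gaussianPDFReal_zero (v : ℝ≥0) (x : ℝ) :
    HasDerivAt (gaussianPDFReal 0 v) (-(x / v) * gaussianPDFReal 0 v x) x := by
  have h : HasDerivAt (fun y : ℝ => -(y - 0) ^ 2 / (2 * v)) (-(x / v)) x := by
    have := (((hasDerivAt_id x).sub_const 0).pow 2).neg.div_const (2 * (v : ℝ))
    convert! this using 1
    simp
    ring
  have := h.exp.const_mul (Real.sqrt (2 * Real.pi * v))⁻¹
  convert! this using 1
  simp only [gaussianPDFReal]
  ring

open scoped NNReal in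
/-- Stein's identity on the line. -/
theorem integral_id_mul_gaussianReal {v : ℝ≥0} (hv : v ≠ 0) {h h' : ℝ → ℝ}
    (hd : ∀ x, HasDerivAt h (h' x) x) (h₀ : Integrable h (gaussianReal 0 v))
    (h₁ : Integrable (fun x => x * h x) (gaussianReal 0 v))
    (h₂ : Integrable h' (gaussianReal 0 v)) :
    ∫ x, x * h x ∂gaussianReal 0 v = v * ∫ x, h' x ∂gaussianReal 0 v := by
  have hv' : (v : ℝ) ≠ 0 := by exact_mod_cast hv
  rw [integrable_gaussianReal_iff hv] at h₀ h₁ h₂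
  rw [integral_gaussianReal_eq_integral_smul hv, integral_gaussianReal_eq_integral_smul hv]
  simp only [smul_eq_mul]
  -- The derivative of density times `h` integrates to zero; integrability of the function and of
  -- its derivative replaces any boundary condition.
  have key := integral_eq_zero_of_hasDerivAt_of_integrable
    (f := fun x => gaussianPDFReal 0 v x * h x)
    (f' := fun x => gaussianPDFReal 0 v x * h' x - (v : ℝ)⁻¹ * (gaussianPDFReal 0 v x * (x * h x)))
    (fun x => by
      convert! (hasDerivAt_gaussianPDFReal_zero v x).mul (hd x) using 1
      field_simp
      ring) (h₂.sub (h₁.const_mul _)) h₀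
  rw [integral_sub h₂ (h₁.const_mul _), integral_const_mul] at key
  rw [sub_eq_zero.1 key, mul_inv_cancel_left₀ hv']

open scoped NNReal in
theorem integral_exp_neg_mul_sq_gaussianReal {v : ℝ≥0} (hv : v ≠ 0) {t : ℝ} (ht : 0 ≤ t) :
    ∫ x, Real.exp (-t * x ^ 2) ∂gaussianReal 0 v = (Real.sqrt (1 + 2 * t * v))⁻¹ := by
  have hv' : (0 : ℝ) < v := by exact_mod_cast pos_iff_ne_zero.2 hv
  rw [integral_gaussianReal_eq_integral_smul hv]
  have e (x : ℝ) : gaussianPDFReal 0 v x • Real.exp (-t * x ^ 2) =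
      (Real.sqrt (2 * Real.pi * v))⁻¹ * Real.exp (-((1 + 2 * t * v) / (2 * v)) * x ^ 2) := by
    rw [gaussianPDFReal, smul_eq_mul, mul_assoc, ← Real.exp_add]
    congr 2
    field_simp
    ring
  simp_rw [e]
  rw [integral_const_mul, integral_gaussian, ← Real.sqrt_inv, ← Real.sqrt_inv,
    ← Real.sqrt_mul (by positivity)]
  congr 1
  have := Real.pi_pos
  field_simp

/-! ### Stein's identity for product measures -/

/-- Resampling one coordinate preserves a product of probability measures. -/
theorem measurePreserving_update_pi {ι : Type*} [Fintype ι] [DecidableEq ι] {α : ι → Type*}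
    [∀ i, MeasurableSpace (α i)] (μ : ∀ i, Measure (α i)) [∀ i, IsProbabilityMeasure (μ i)]
    (j : ι) : MeasurePreserving (fun p : (∀ i, α i) × α j => Function.update p.1 j p.2)
      ((Measure.pi μ).prod (μ j)) (Measure.pi μ) := by
  have hm : Measurable (fun p : (∀ i, α i) × α j => Function.update p.1 j p.2) := by
    refine measurable_pi_iff.2 fun i => ?_
    by_cases h : i = j
    · subst h; simpa using measurable_snd
    · simp only [Function.update_of_ne h]; fun_prop
  refine ⟨hm, (Measure.pi_eq fun s hs => ?_).symm⟩
  have e : (fun p : (∀ i, α i) × α j => Function.update p.1 j p.2) ⁻¹' Set.univ.pi s =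
      Set.univ.pi (Function.update s j Set.univ) ×ˢ s j := by
    ext ⟨x, y⟩
    simp only [Set.mem_preimage, Set.mem_pi, Set.mem_univ, true_imp_iff, Set.mem_prod]
    constructor
    · intro h
      refine ⟨fun i => ?_, by simpa using h j⟩
      by_cases hi : i = j
      · subst hi; simp
      · simpa [hi] using h i
    · rintro ⟨h, hj⟩ i
      by_cases hi : i = j
      · subst hi; simpa using hj
      · simpa [hi] using h i
  rw [Measure.map_apply hm (MeasurableSet.univ_pi hs), e, Measure.prod_prod, Measure.pi_pi,
    ← Finset.prod_erase_mul Finset.univ _ (Finset.mem_univ j),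
    ← Finset.prod_erase_mul Finset.univ _ (Finset.mem_univ j)]
  simp only [Function.update_self, measure_univ, mul_one]
  congr 1
  exact Finset.prod_congr rfl fun i hi => by rw [Function.update_of_ne (Finset.ne_of_mem_erase hi)]

open scoped NNReal in
/-- Stein's identity in one coordinate of a centred Gaussian vector. -/
theorem integral_coord_mul_pi_gaussianReal {ι : Type*} [Fintype ι] [DecidableEq ι] {v : ι → ℝ≥0}
    {j : ι} (hv : v j ≠ 0) {F F' : (ι → ℝ) → ℝ}
    (hd : ∀ᵐ w ∂Measure.pi fun i => gaussianReal 0 (v i), ∀ s : ℝ,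
      HasDerivAt (fun s => F (Function.update w j s)) (F' (Function.update w j s)) s)
    (h₀ : Integrable F (Measure.pi fun i => gaussianReal 0 (v i)))
    (h₁ : Integrable (fun w => w j * F w) (Measure.pi fun i => gaussianReal 0 (v i)))
    (h₂ : Integrable F' (Measure.pi fun i => gaussianReal 0 (v i))) :
    ∫ w, w j * F w ∂Measure.pi (fun i => gaussianReal 0 (v i)) =
      v j * ∫ w, F' w ∂Measure.pi fun i => gaussianReal 0 (v i) := by
  have hp := measurePreserving_update_pi (fun i => gaussianReal 0 (v i)) j
  have k₀ := hp.integrable_comp_of_integrable h₀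
  have k₁ := hp.integrable_comp_of_integrable h₁
  have k₂ := hp.integrable_comp_of_integrable h₂
  simp only [Function.comp_def] at k₀ k₁ k₂
  have i₁ := integral_map (f := fun w => w j * F w) hp.measurable.aemeasurable
    (by rw [hp.map_eq]; exact h₁.1)
  have i₂ := integral_map (f := F') hp.measurable.aemeasurable (by rw [hp.map_eq]; exact h₂.1)
  rw [hp.map_eq] at i₁ i₂
  -- After resampling, the inner integral runs over coordinate `j` alone with the others frozen,
  -- where the identity on the line applies.
  rw [i₁, i₂, integral_prod _ k₁, integral_prod _ k₂, ← integral_const_mul]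
  refine integral_congr_ae ?_
  filter_upwards [hd, k₀.prod_right_ae, k₁.prod_right_ae, k₂.prod_right_ae] with w hw a₀ a₁ a₂
  simp only [Function.update_self] at a₀ a₁ a₂ ⊢
  exact integral_id_mul_gaussianReal hv hw a₀ a₁ a₂

/-! ### Laplace transforms and inverse moments of sums of squares -/

open scoped NNReal in
/-- The law of a vector with independent centred Gaussian coordinates. -/
noncomputable abbrev gaussPi {ι : Type*} [Fintype ι] (v : ι → ℝ≥0) : Measure (ι → ℝ) :=
  Measure.pi fun i => gaussianReal 0 (v i)

-- The sum of the two variables is Gaussian with variance `a + b`, by convolution.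
open scoped NNReal in
theorem integral_exp_neg_mul_add_sq_gaussianReal {a b : ℝ≥0} (hb : b ≠ 0) {t : ℝ} (ht : 0 ≤ t) :
    ∫ z, ∫ w, Real.exp (-t * (z + w) ^ 2) ∂gaussianReal 0 b ∂gaussianReal 0 a =
      (Real.sqrt (1 + 2 * t * (a + b)))⁻¹ := by
  have h := integral_exp_neg_mul_sq_gaussianReal (v := a + b) (by positivity) ht
  rw [← add_zero (0 : ℝ), ← gaussianReal_conv_gaussianReal, integral_conv] at h
  · simpa using h
  · refine Integrable.of_bound (C := 1) (by fun_prop) (ae_of_all _ fun x => ?_)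
    rw [Real.norm_eq_abs, Real.abs_exp, Real.exp_le_one_iff]
    nlinarith [mul_nonneg ht (sq_nonneg x)]

open scoped NNReal in
theorem integral_exp_neg_mul_sum_sq {ι : Type*} [Fintype ι] [DecidableEq ι] (s : Finset ι)
    (l : ι → ℝ≥0) {v : ι → ℝ≥0} (hv : ∀ i, v i ≠ 0) {t : ℝ} (ht : 0 ≤ t) :
    ∫ p : (ι → ℝ) × (ι → ℝ), Real.exp (-t * ∑ j ∈ s, (p.1 j + p.2 j) ^ 2)
        ∂(gaussPi l).prod (gaussPi v) =
      ∏ j ∈ s, (Real.sqrt (1 + 2 * t * (l j + v j)))⁻¹ := by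
  -- Coordinates outside `s` contribute the factor 1, so that the integrand is a product over all of
  -- `ι` and factorises under the product measures.
  have e (z w : ι → ℝ) : Real.exp (-t * ∑ j ∈ s, (z j + w j) ^ 2) =
      ∏ j, if j ∈ s then Real.exp (-t * (z j + w j) ^ 2) else 1 := by
    rw [Finset.prod_ite_mem, Finset.univ_inter, Finset.mul_sum, Real.exp_sum]
  rw [integral_prod]
  · simp_rw [e]
    have h₁ (z : ι → ℝ) := integral_fintype_prod_eq_prod (𝕜 := ℝ)
      (μ := fun i => gaussianReal 0 (v i))
      (fun j w => if j ∈ s then Real.exp (-t * (z j + w) ^ 2) else 1)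
    have h₂ := integral_fintype_prod_eq_prod (𝕜 := ℝ)
      (μ := fun i => gaussianReal 0 (l i))
      (fun j z => ∫ w, (if j ∈ s then Real.exp (-t * (z + w) ^ 2) else 1) ∂gaussianReal 0 (v j))
    simp_rw [h₁, h₂]
    rw [← Finset.univ_inter s, ← Finset.prod_ite_mem]
    refine Finset.prod_congr rfl fun j _ => ?_
    by_cases hj : j ∈ s
    · simp only [hj, if_true, Finset.univ_inter]
      exact integral_exp_neg_mul_add_sq_gaussianReal (hv j) ht
    · simp [hj]
  · refine Integrable.of_bound (C := 1) (by fun_prop) (ae_of_all _ fun x => ?_)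
    rw [Real.norm_eq_abs, Real.abs_exp, Real.exp_le_one_iff]
    have := mul_nonneg ht (Finset.sum_nonneg fun j (_ : j ∈ s) => sq_nonneg (x.1 j + x.2 j))
    linarith

/-- Stated in `[0, ∞]` so that Tonelli can exchange it with an expectation before integrability of
the inverse is known. -/
theorem ofReal_inv_eq_lintegral_exp {q : ℝ} (hq : 0 < q) :
    ENNReal.ofReal q⁻¹ = ∫⁻ t in Set.Ioi 0, ENNReal.ofReal (Real.exp (-t * q)) := by
  have h := integral_exp_mul_Ioi (a := -q) (by linarith) 0
  have h' := integrableOn_exp_mul_Ioi (a := -q) (by linarith) 0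
  rw [← ofReal_integral_eq_lintegral_ofReal]
  · simp only [mul_zero, Real.exp_zero] at h
    simp_rw [neg_mul_comm, mul_comm _ (-q)]
    rw [h]
    congr 1
    field_simp
  · simp_rw [neg_mul_comm, mul_comm _ (-q)]
    exact h'
  · exact ae_of_all _ fun t => (Real.exp_pos _).le

open scoped NNReal in
theorem ae_add_eval_ne_zero {ι : Type*} [Fintype ι] {v : ι → ℝ≥0} {j : ι} (hv : v j ≠ 0)
    (z : ι → ℝ) : ∀ᵐ w ∂gaussPi v, z j + w j ≠ 0 := by
  have : NullSingletonClass (gaussianReal 0 (v j)) := nullSingletonClass_gaussianReal hv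
  filter_upwards [Measure.ae_eval_ne (μ := fun i => gaussianReal 0 (v i)) j (-z j)] with w hw h
  exact hw (by linarith)

open scoped NNReal in
/-- The inverse moment of a partial squared norm of a Gaussian vector. -/
theorem lintegral_inv_sum_sq {ι : Type*} [Fintype ι] [DecidableEq ι] {s : Finset ι}
    (hs : s.Nonempty) (l : ι → ℝ≥0) {v : ι → ℝ≥0} (hv : ∀ i, v i ≠ 0) :
    ∫⁻ p : (ι → ℝ) × (ι → ℝ), ENNReal.ofReal (∑ j ∈ s, (p.1 j + p.2 j) ^ 2)⁻¹
        ∂(gaussPi l).prod (gaussPi v) =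
      ∫⁻ t in Set.Ioi 0, ENNReal.ofReal (∏ j ∈ s, (Real.sqrt (1 + 2 * t * (l j + v j)))⁻¹) := by
  obtain ⟨k, hk⟩ := hs
  have hae : ∀ᵐ p ∂(gaussPi l).prod (gaussPi v), 0 < ∑ j ∈ s, (p.1 j + p.2 j) ^ 2 := by
    rw [Measure.ae_prod_iff_ae_ae (measurableSet_lt (by fun_prop) (by fun_prop))]
    refine ae_of_all _ fun z => ?_
    filter_upwards [ae_add_eval_ne_zero (hv k) z] with w hw
    exact Finset.sum_pos' (fun _ _ => sq_nonneg _) ⟨k, hk, by positivity⟩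
  calc _ = ∫⁻ p, (∫⁻ t in Set.Ioi 0, ENNReal.ofReal
          (Real.exp (-t * ∑ j ∈ s, (p.1 j + p.2 j) ^ 2))) ∂(gaussPi l).prod (gaussPi v) :=
        lintegral_congr_ae (hae.mono fun p hp => ofReal_inv_eq_lintegral_exp hp)
    _ = ∫⁻ t in Set.Ioi 0, ∫⁻ p, ENNReal.ofReal
          (Real.exp (-t * ∑ j ∈ s, (p.1 j + p.2 j) ^ 2)) ∂(gaussPi l).prod (gaussPi v) :=
        lintegral_lintegral_swap (by fun_prop)
    _ = _ := by
      refine setLIntegral_congr_fun measurableSet_Ioi fun t ht => ?_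
      rw [← integral_exp_neg_mul_sum_sq s l hv (le_of_lt ht), ofReal_integral_eq_lintegral_ofReal]
      · refine Integrable.of_bound (C := 1) (by fun_prop) (ae_of_all _ fun x => ?_)
        rw [Real.norm_eq_abs, Real.abs_exp, Real.exp_le_one_iff]
        have := mul_nonneg (le_of_lt ht)
          (Finset.sum_nonneg fun j (_ : j ∈ s) => sq_nonneg (x.1 j + x.2 j))
        linarith
      · exact ae_of_all _ fun _ => (Real.exp_pos _).le

/-! ### Stein's computation of the shrinkage risk -/

theorem hasDerivAt_div_sq_add {z Q : ℝ} (hQ : 0 < Q) (y : ℝ) :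
    HasDerivAt (fun y => (z + y) / ((z + y) ^ 2 + Q))
      (((z + y) ^ 2 + Q)⁻¹ - 2 * ((z + y) / ((z + y) ^ 2 + Q)) ^ 2) y := by
  have hne : (z + y) ^ 2 + Q ≠ 0 := by positivity
  have h₁ : HasDerivAt (fun y => z + y) 1 y := (hasDerivAt_id y).const_add z
  convert! h₁.div ((h₁.pow 2).add_const Q) hne using 1
  simp
  field_simp

/-- This bound makes integrability of the inverse squared norm the only hypothesis needed for all
the terms below. -/
theorem div_sq_le_inv {x q : ℝ} (h : x ^ 2 ≤ q) : (x / q) ^ 2 ≤ q⁻¹ := by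
  rcases (le_trans (sq_nonneg x) h).eq_or_lt with hq | hq
  · simp [← hq]
  · rw [div_pow, div_le_iff₀ (by positivity)]
    calc x ^ 2 ≤ q := h
      _ = q⁻¹ * q ^ 2 := by field_simp

section

open scoped NNReal

variable {ι : Type*} [Fintype ι] {s : Finset ι} {l v : ι → ℝ≥0}

theorem integrable_sq_snd_eval (j : ι) :
    Integrable (fun p : (ι → ℝ) × (ι → ℝ) => p.2 j ^ 2) ((gaussPi l).prod (gaussPi v)) := by
  have h : Integrable (fun x : ℝ => x ^ 2) (gaussianReal 0 (v j)) :=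
    (memLp_id_gaussianReal 2).integrable_sq
  have h₁ := (measurePreserving_eval (fun i => gaussianReal 0 (v i)) j).integrable_comp_of_integrable h
  exact h₁.comp_snd _

theorem integral_sq_snd_eval (j : ι) :
    ∫ p : (ι → ℝ) × (ι → ℝ), p.2 j ^ 2 ∂(gaussPi l).prod (gaussPi v) = v j := by
  have h := variance_fun_id_gaussianReal (μ := 0) (v := v j)
  rw [variance_eq_integral (by fun_prop)] at h
  simp only [integral_id_gaussianReal, sub_zero] at h
  rw [integral_fun_snd (fun w : ι → ℝ => w j ^ 2)]
  have h₂ := integral_map (μ := gaussPi v) (φ := fun w => w j) (f := fun x : ℝ => x ^ 2)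
    (measurable_pi_apply j).aemeasurable (by fun_prop)
  rw [(measurePreserving_eval (fun i => gaussianReal 0 (v i)) j).map_eq] at h₂
  simp [← h₂, h]

theorem integrable_sq_div (h : Integrable (fun p : (ι → ℝ) × (ι → ℝ) =>
    (∑ k ∈ s, (p.1 k + p.2 k) ^ 2)⁻¹) ((gaussPi l).prod (gaussPi v))) {j : ι} (hj : j ∈ s) :
    Integrable (fun p : (ι → ℝ) × (ι → ℝ) =>
      ((p.1 j + p.2 j) / ∑ k ∈ s, (p.1 k + p.2 k) ^ 2) ^ 2)
      ((gaussPi l).prod (gaussPi v)) := by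
  refine h.mono'
    (Measurable.aestronglyMeasurable (by fun_prop)) (ae_of_all _ fun p => ?_)
  rw [Real.norm_of_nonneg (sq_nonneg _)]
  exact div_sq_le_inv (Finset.single_le_sum (f := fun k => (p.1 k + p.2 k) ^ 2)
    (fun _ _ => sq_nonneg _) hj)

theorem integrable_div (h : Integrable (fun p : (ι → ℝ) × (ι → ℝ) =>
    (∑ k ∈ s, (p.1 k + p.2 k) ^ 2)⁻¹) ((gaussPi l).prod (gaussPi v))) {j : ι} (hj : j ∈ s) :
    Integrable (fun p : (ι → ℝ) × (ι → ℝ) =>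
      (p.1 j + p.2 j) / ∑ k ∈ s, (p.1 k + p.2 k) ^ 2) ((gaussPi l).prod (gaussPi v)) := by
  refine ((integrable_const 1).add (integrable_sq_div h hj)).mono'
    (Measurable.aestronglyMeasurable (by fun_prop))
    (ae_of_all _ fun p => ?_)
  rw [Real.norm_eq_abs, Pi.add_apply]
  nlinarith [sq_abs ((p.1 j + p.2 j) / ∑ k ∈ s, (p.1 k + p.2 k) ^ 2),
    sq_nonneg (|(p.1 j + p.2 j) / ∑ k ∈ s, (p.1 k + p.2 k) ^ 2| - 1)]

theorem integrable_mul_div (h : Integrable (fun p : (ι → ℝ) × (ι → ℝ) =>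
    (∑ k ∈ s, (p.1 k + p.2 k) ^ 2)⁻¹) ((gaussPi l).prod (gaussPi v))) {j : ι} (hj : j ∈ s) :
    Integrable (fun p : (ι → ℝ) × (ι → ℝ) =>
      p.2 j * ((p.1 j + p.2 j) / ∑ k ∈ s, (p.1 k + p.2 k) ^ 2))
      ((gaussPi l).prod (gaussPi v)) := by
  refine ((integrable_sq_snd_eval j).add (integrable_sq_div h hj)).mono'
    (Measurable.aestronglyMeasurable (by fun_prop))
    (ae_of_all _ fun p => ?_)
  rw [Real.norm_eq_abs, Pi.add_apply, abs_le]
  constructor <;>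
  nlinarith [sq_nonneg (p.2 j - (p.1 j + p.2 j) / ∑ k ∈ s, (p.1 k + p.2 k) ^ 2),
    sq_nonneg (p.2 j + (p.1 j + p.2 j) / ∑ k ∈ s, (p.1 k + p.2 k) ^ 2),
    sq_nonneg (p.2 j), sq_nonneg ((p.1 j + p.2 j) / ∑ k ∈ s, (p.1 k + p.2 k) ^ 2)]

theorem integrable_inv_sub_sq_div (h : Integrable (fun p : (ι → ℝ) × (ι → ℝ) =>
    (∑ k ∈ s, (p.1 k + p.2 k) ^ 2)⁻¹) ((gaussPi l).prod (gaussPi v))) {j : ι} (hj : j ∈ s) :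
    Integrable (fun p : (ι → ℝ) × (ι → ℝ) => (∑ k ∈ s, (p.1 k + p.2 k) ^ 2)⁻¹ -
        2 * ((p.1 j + p.2 j) / ∑ k ∈ s, (p.1 k + p.2 k) ^ 2) ^ 2)
      ((gaussPi l).prod (gaussPi v)) :=
  h.sub ((integrable_sq_div h hj).const_mul 2)

variable [DecidableEq ι]

/-- Stein's identity in the noise coordinate `j`, with the mean `p.1` held fixed. Since `s` has a
second element `k`, whose coordinate is almost surely nonzero, the denominator does not vanish
anywhere on almost every line in direction `j`. -/
theorem integral_mul_div (h : Integrable (fun p : (ι → ℝ) × (ι → ℝ) =>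
    (∑ k ∈ s, (p.1 k + p.2 k) ^ 2)⁻¹) ((gaussPi l).prod (gaussPi v))) (hv : ∀ i, v i ≠ 0)
    (hs : 2 ≤ s.card) {j : ι} (hj : j ∈ s) :
    ∫ p : (ι → ℝ) × (ι → ℝ), p.2 j * ((p.1 j + p.2 j) / ∑ k ∈ s, (p.1 k + p.2 k) ^ 2)
        ∂(gaussPi l).prod (gaussPi v) =
      v j * ∫ p : (ι → ℝ) × (ι → ℝ), ((∑ k ∈ s, (p.1 k + p.2 k) ^ 2)⁻¹ -
        2 * ((p.1 j + p.2 j) / ∑ k ∈ s, (p.1 k + p.2 k) ^ 2) ^ 2)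
        ∂(gaussPi l).prod (gaussPi v) := by
  have h₀ := integrable_div h hj
  have h₁ := integrable_mul_div h hj
  have h₂ := integrable_inv_sub_sq_div h hj
  rw [integral_prod _ h₁, integral_prod _ h₂, ← integral_const_mul]
  obtain ⟨k, hk, hkj⟩ := Finset.exists_mem_ne (show 1 < s.card by lia) j
  refine integral_congr_ae ?_
  filter_upwards [h₀.prod_right_ae, h₁.prod_right_ae, h₂.prod_right_ae] with z a₀ a₁ a₂
  refine integral_coord_mul_pi_gaussianReal (hv j) ?_ a₀ a₁ a₂
  filter_upwards [ae_add_eval_ne_zero (hv k) z] with w hw t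
  have hQ : 0 < ∑ i ∈ s.erase j, (z i + w i) ^ 2 :=
    Finset.sum_pos' (fun _ _ => sq_nonneg _) ⟨k, Finset.mem_erase.2 ⟨hkj, hk⟩, by positivity⟩
  have e (y : ℝ) : ∑ i ∈ s, (z i + Function.update w j y i) ^ 2 =
      (z j + y) ^ 2 + ∑ i ∈ s.erase j, (z i + w i) ^ 2 := by
    rw [← Finset.add_sum_erase s _ hj, Function.update_self]
    congr 1
    exact Finset.sum_congr rfl fun i hi => by rw [Function.update_of_ne (Finset.ne_of_mem_erase hi)]
  simpa only [e, Function.update_self] using hasDerivAt_div_sq_add hQ t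

/-- The Bayes risk of a James-Stein estimator shrinking the coordinates in `s`. -/
theorem integral_shrinkage_loss (h : Integrable (fun p : (ι → ℝ) × (ι → ℝ) =>
    (∑ k ∈ s, (p.1 k + p.2 k) ^ 2)⁻¹) ((gaussPi l).prod (gaussPi v))) {τ : ℝ≥0} (hτ : τ ≠ 0)
    (hv : ∀ i, v i = τ) (hs : 2 ≤ s.card) :
    Integrable (fun p : (ι → ℝ) × (ι → ℝ) => ∑ j, (p.2 j - if j ∈ s then
        τ * (s.card - 2) * ((p.1 j + p.2 j) / ∑ k ∈ s, (p.1 k + p.2 k) ^ 2) else 0) ^ 2)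
      ((gaussPi l).prod (gaussPi v)) ∧
    ∫ p : (ι → ℝ) × (ι → ℝ), ∑ j, (p.2 j - if j ∈ s then
        τ * (s.card - 2) * ((p.1 j + p.2 j) / ∑ k ∈ s, (p.1 k + p.2 k) ^ 2) else 0) ^ 2
        ∂(gaussPi l).prod (gaussPi v) =
      τ * Fintype.card ι - τ ^ 2 * ((s.card : ℝ) - 2) ^ 2 *
        ∫ p : (ι → ℝ) × (ι → ℝ), (∑ k ∈ s, (p.1 k + p.2 k) ^ 2)⁻¹
          ∂(gaussPi l).prod (gaussPi v) := by
  set c : ℝ := τ * (s.card - 2) with hc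
  have hsum (p : (ι → ℝ) × (ι → ℝ)) :
      ∑ j ∈ s, ((p.1 j + p.2 j) / ∑ k ∈ s, (p.1 k + p.2 k) ^ 2) ^ 2 =
        (∑ k ∈ s, (p.1 k + p.2 k) ^ 2)⁻¹ := by
    simp_rw [div_pow]
    rw [← Finset.sum_div]
    by_cases hq : ∑ k ∈ s, (p.1 k + p.2 k) ^ 2 = 0
    · simp [hq]
    · field_simp
  have e (p : (ι → ℝ) × (ι → ℝ)) : ∑ j, (p.2 j - if j ∈ s then
        c * ((p.1 j + p.2 j) / ∑ k ∈ s, (p.1 k + p.2 k) ^ 2) else 0) ^ 2 =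
      ∑ j, p.2 j ^ 2 - 2 * c *
        ∑ j ∈ s, p.2 j * ((p.1 j + p.2 j) / ∑ k ∈ s, (p.1 k + p.2 k) ^ 2) +
      c ^ 2 * (∑ k ∈ s, (p.1 k + p.2 k) ^ 2)⁻¹ := by
    rw [← hsum p]
    generalize ∑ k ∈ s, (p.1 k + p.2 k) ^ 2 = q
    have hs' (f : ι → ℝ) : ∑ j ∈ s, f j = ∑ j, if j ∈ s then f j else 0 := by simp
    rw [Finset.mul_sum, Finset.mul_sum, hs', hs', ← Finset.sum_sub_distrib,
      ← Finset.sum_add_distrib]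
    refine Finset.sum_congr rfl fun j _ => ?_
    by_cases hj : j ∈ s
    · simp only [hj, if_true]; ring
    · simp [hj]
  simp_rw [e]
  have i₁ : Integrable (fun p : (ι → ℝ) × (ι → ℝ) => ∑ j, p.2 j ^ 2)
      ((gaussPi l).prod (gaussPi v)) :=
    integrable_finsetSum _ fun j _ => integrable_sq_snd_eval j
  have i₂ : Integrable (fun p : (ι → ℝ) × (ι → ℝ) => 2 * c *
      ∑ j ∈ s, p.2 j * ((p.1 j + p.2 j) / ∑ k ∈ s, (p.1 k + p.2 k) ^ 2))
      ((gaussPi l).prod (gaussPi v)) :=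
    (integrable_finsetSum _ fun j hj => integrable_mul_div h hj).const_mul _
  refine ⟨(i₁.sub i₂).add (h.const_mul _), ?_⟩
  -- Summing the Stein terms over `s` gives `τ(|s| - 2)/Q = c/Q`, so the cross and quadratic parts
  -- combine to `-2c² + c² = -c²` times the inverse moment.
  have hcross : ∫ p : (ι → ℝ) × (ι → ℝ),
      ∑ j ∈ s, p.2 j * ((p.1 j + p.2 j) / ∑ k ∈ s, (p.1 k + p.2 k) ^ 2)
        ∂(gaussPi l).prod (gaussPi v) =
      c * ∫ p : (ι → ℝ) × (ι → ℝ), (∑ k ∈ s, (p.1 k + p.2 k) ^ 2)⁻¹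
          ∂(gaussPi l).prod (gaussPi v) := by
    rw [integral_finsetSum _ fun j hj => integrable_mul_div h hj,
      Finset.sum_congr rfl fun j hj => integral_mul_div h (fun i => by rwa [hv i]) hs hj]
    simp_rw [hv]
    rw [← Finset.mul_sum, ← integral_finsetSum _ fun j hj => integrable_inv_sub_sq_div h hj, hc, mul_assoc,
      ← integral_const_mul ((s.card : ℝ) - 2)]
    congr 1
    refine integral_congr_ae (ae_of_all _ fun p => ?_)
    beta_reduce
    rw [Finset.sum_sub_distrib, ← Finset.mul_sum, hsum p]
    simp
    ring
  rw [integral_add (by exact i₁.sub i₂) (h.const_mul _), integral_sub i₁ i₂, integral_const_mul,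
    integral_const_mul, hcross, integral_finsetSum _ fun j _ => integrable_sq_snd_eval j]
  simp_rw [integral_sq_snd_eval, hv]
  simp
  rw [hc]
  ring

end

/-! ### Reduction to principal coordinates -/

section

open scoped NNReal RealInnerProductSpace

variable {ι : Type*} [Fintype ι]

theorem charFun_map_gaussPi {E : Type*} [NormedAddCommGroup E] [InnerProductSpace ℝ E]
    [MeasurableSpace E] [BorelSpace E] [SecondCountableTopology E] (b : ι → E) (v : ι → ℝ≥0)
    (m t : E) :
    charFun ((gaussPi v).map fun w => m + ∑ j, w j • b j) t =
      Complex.exp ((⟪m, t⟫ : ℝ) * Complex.I - ((∑ j, v j * ⟪b j, t⟫ ^ 2 : ℝ) : ℂ) / 2) := by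
  rw [charFun_apply, integral_map (Measurable.aemeasurable (by fun_prop))
    (Measurable.aestronglyMeasurable (by fun_prop))]
  simp_rw [inner_add_left, sum_inner, real_inner_smul_left, Complex.ofReal_add, add_mul,
    Complex.exp_add, Complex.ofReal_sum, Finset.sum_mul, Complex.exp_sum]
  rw [integral_const_mul, integral_fintype_prod_eq_prod (𝕜 := ℂ)
    (f := fun j x => Complex.exp ((x * ⟪b j, t⟫ : ℝ) * Complex.I))]
  have e (j : ι) : ∫ x, Complex.exp ((x * ⟪b j, t⟫ : ℝ) * Complex.I) ∂gaussianReal 0 (v j) =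
      Complex.exp (-((v j * ⟪b j, t⟫ ^ 2 : ℝ) : ℂ) / 2) := by
    have h := charFun_gaussianReal (μ := 0) (v := v j) ⟪b j, t⟫
    rw [charFun_apply_real] at h
    simp_rw [show ∀ x : ℝ, ((x * ⟪b j, t⟫ : ℝ) : ℂ) = (⟪b j, t⟫ : ℂ) * x by
      intro x; push_cast; ring]
    rw [h]
    congr 1
    push_cast
    ring
  simp_rw [e]
  rw [← Complex.exp_sum, ← Complex.exp_add, Finset.sum_div, sub_eq_add_neg,
    ← Finset.sum_neg_distrib]
  simp_rw [neg_div]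

namespace NormalMeans

theorem charFun_map_dataLaw {n d : ℕ} (hn : n ≠ 0) (μ t : EuclideanSpace ℝ (Fin d)) :
    charFun ((dataLaw n μ).map fun Y => WithLp.toLp 2 (sampleMean Y)) t =
      Complex.exp ((⟪μ, t⟫ : ℝ) * Complex.I - ((‖t‖ ^ 2 / n : ℝ) : ℂ) / 2) := by
  have hm : Measurable fun Y : Fin n → Fin d → ℝ => WithLp.toLp 2 (sampleMean Y) := by
    unfold sampleMean
    fun_prop
  have e (Y : Fin n → Fin d → ℝ) : Complex.exp ((⟪WithLp.toLp 2 (sampleMean Y), t⟫ : ℝ) *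
      Complex.I) = ∏ i, ∏ j, Complex.exp ((t j / n : ℝ) * Y i j * Complex.I) := by
    simp_rw [← Complex.exp_sum]
    congr 1
    rw [Finset.sum_comm]
    simp only [PiLp.inner_apply, sampleMean, RCLike.inner_apply, conj_trivial]
    push_cast
    rw [Finset.sum_mul]
    refine Finset.sum_congr rfl fun j _ => ?_
    rw [← Finset.sum_mul, ← Finset.mul_sum]
    ring
  rw [charFun_apply, integral_map hm.aemeasurable (Measurable.aestronglyMeasurable (by fun_prop))]
  simp_rw [e]
  rw [dataLaw, integral_fintype_prod_eq_prod (𝕜 := ℂ)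
    (f := fun (_ : Fin n) (y : Fin d → ℝ) => ∏ j, Complex.exp ((t j / n : ℝ) * y j * Complex.I))]
  simp_rw [integral_fintype_prod_eq_prod (𝕜 := ℂ)
    (f := fun j (x : ℝ) => Complex.exp ((t j / n : ℝ) * x * Complex.I)), ← charFun_apply_real,
    charFun_gaussianReal]
  rw [Finset.prod_const, ← Complex.exp_sum, ← Complex.exp_nat_mul, EuclideanSpace.real_norm_sq_eq]
  congr 1
  have hn' : (n : ℂ) ≠ 0 := by exact_mod_cast hn
  simp only [PiLp.inner_apply, RCLike.inner_apply, conj_trivial, Finset.card_univ,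
    Fintype.card_fin]
  push_cast
  rw [Finset.sum_mul, Finset.sum_div, Finset.sum_div, ← Finset.sum_sub_distrib, Finset.mul_sum]
  refine Finset.sum_congr rfl fun j _ => ?_
  field_simp

/-- Isotropic noise is rotation invariant: by Parseval the characteristic function does not depend
on the basis. -/
theorem map_dataLaw {n d : ℕ} (hn : n ≠ 0) (b : OrthonormalBasis (Fin d) ℝ (EuclideanSpace ℝ (Fin d)))
    (μ : EuclideanSpace ℝ (Fin d)) :
    (dataLaw n μ).map (fun Y => WithLp.toLp 2 (sampleMean Y)) =
      (gaussPi fun _ => (n : ℝ≥0)⁻¹).map fun w => μ + ∑ j, w j • b j := by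
  have : IsProbabilityMeasure (dataLaw n μ) := by unfold dataLaw; infer_instance
  have hm : Measurable fun Y : Fin n → Fin d → ℝ => WithLp.toLp 2 (sampleMean Y) := by
    unfold sampleMean
    fun_prop
  have := Measure.isProbabilityMeasure_map (μ := dataLaw n μ) hm.aemeasurable
  refine Measure.ext_of_charFun (funext fun t => ?_)
  rw [charFun_map_dataLaw hn, charFun_map_gaussPi, ← Finset.mul_sum, b.sum_sq_inner_right]
  congr 4
  simp
  ring

/-- The principal axis of the compound symmetric matrix. -/
theorem exists_basis_eq_const {d : ℕ} (i₀ : Fin d) :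
    ∃ b : OrthonormalBasis (Fin d) ℝ (EuclideanSpace ℝ (Fin d)),
      b i₀ = WithLp.toLp 2 fun _ => (Real.sqrt d)⁻¹ := by
  have hd : (0 : ℝ) < d := by exact_mod_cast i₀.pos
  have h : Orthonormal ℝ (({i₀} : Set (Fin d)).domRestrict fun _ =>
      (WithLp.toLp 2 fun _ => (Real.sqrt d)⁻¹ : EuclideanSpace ℝ (Fin d))) := by
    refine ⟨fun i => ?_, fun i j hij => (hij (Subsingleton.elim i j)).elim⟩
    rw [Set.domRestrict_apply, EuclideanSpace.norm_eq]
    simp [hd.ne']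
  obtain ⟨b, hb⟩ := h.exists_orthonormalBasis_extension_of_card_eq (by simp)
  exact ⟨b, hb i₀ rfl⟩

theorem inner_const {d : ℕ} (x : EuclideanSpace ℝ (Fin d)) :
    ⟪(WithLp.toLp 2 fun _ => (Real.sqrt d)⁻¹ : EuclideanSpace ℝ (Fin d)), x⟫ =
      (Real.sqrt d)⁻¹ * ∑ j, x j := by
  rw [Finset.mul_sum]
  simp only [PiLp.inner_apply, RCLike.inner_apply, conj_trivial, mul_comm]

theorem compoundSymm_quadratic {d : ℕ} (ρ : ℝ) (x : Fin d → ℝ) :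
    x ⬝ᵥ compoundSymm d ρ *ᵥ x = (1 - ρ) * ∑ i, x i ^ 2 + ρ * (∑ i, x i) ^ 2 := by
  rw [compoundSymm, Matrix.add_mulVec, Matrix.smul_mulVec, Matrix.smul_mulVec,
    Matrix.one_mulVec, dotProduct_add, dotProduct_smul, dotProduct_smul,
    Matrix.vecMulVec_mulVec, dotProduct_smul]
  simp [dotProduct, sq]

/-- The eigenvalues of the compound symmetric matrix. -/
noncomputable def axisVar {d : ℕ} (i₀ : Fin d) (ρ : ℝ) (j : Fin d) : ℝ≥0 :=
  if j = i₀ then (1 + ((d : ℝ) - 1) * ρ).toNNReal else (1 - ρ).toNNReal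

/-- The quadratic form is `(1-ρ)‖t‖² + ρd⟪b i₀, t⟫²`, so it is diagonal in `b`, with eigenvalue `1 -
ρ + dρ` on `b i₀` and `1 - ρ` elsewhere; characteristic functions then agree. -/
theorem multivariateGaussian_compoundSymm {d : ℕ} (hd : 2 ≤ d) {ρ : ℝ}
    (h₀ : -1 / ((d : ℝ) - 1) < ρ) (h₁ : ρ < 1) {i₀ : Fin d}
    {b : OrthonormalBasis (Fin d) ℝ (EuclideanSpace ℝ (Fin d))}
    (hb : b i₀ = WithLp.toLp 2 fun _ => (Real.sqrt d)⁻¹) :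
    multivariateGaussian 0 (compoundSymm d ρ) =
      (gaussPi (axisVar i₀ ρ)).map fun z => ∑ j, z j • b j := by
  have hd' : (0 : ℝ) < (d : ℝ) - 1 := by
    have : (2 : ℝ) ≤ d := by exact_mod_cast hd
    linarith
  have h₂ : 0 < 1 + ((d : ℝ) - 1) * ρ := by
    rw [div_lt_iff₀ hd'] at h₀
    linarith
  have hm : Measurable fun z : Fin d → ℝ => ∑ j, z j • b j := by fun_prop
  have := Measure.isProbabilityMeasure_map (μ := gaussPi (axisVar i₀ ρ)) hm.aemeasurable
  refine Measure.ext_of_charFun (funext fun t => ?_)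
  have e := charFun_map_gaussPi b (axisVar i₀ ρ) 0 t
  simp only [zero_add] at e
  rw [e, charFun_multivariateGaussian (compoundSymm_posDef hd h₀ h₁).posSemidef, inner_zero_left,
    inner_zero_right, compoundSymm_quadratic, ← EuclideanSpace.real_norm_sq_eq,
    ← b.sum_sq_inner_right, ← Finset.add_sum_erase _ _ (Finset.mem_univ i₀),
    ← Finset.add_sum_erase _ (fun j => (axisVar i₀ ρ j : ℝ) * _) (Finset.mem_univ i₀)]
  congr 4
  have he : ∑ j ∈ Finset.univ.erase i₀, (axisVar i₀ ρ j : ℝ) * ⟪b j, t⟫ ^ 2 =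
      (1 - ρ) * ∑ j ∈ Finset.univ.erase i₀, ⟪b j, t⟫ ^ 2 := by
    rw [Finset.mul_sum]
    refine Finset.sum_congr rfl fun j hj => ?_
    rw [axisVar, if_neg (Finset.ne_of_mem_erase hj), Real.coe_toNNReal _ (by linarith)]
  rw [he, axisVar, if_pos rfl, Real.coe_toNNReal _ h₂.le]
  have hs : (∑ i, t i) ^ 2 = d * ⟪b i₀, t⟫ ^ 2 := by
    rw [hb, inner_const, mul_pow, inv_pow, Real.sq_sqrt (by positivity)]
    have : (d : ℝ) ≠ 0 := by positivity
    field_simp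
  rw [hs]
  ring

/-- Parseval in `b`: the mean `z` cancels and the noise `w` remains, corrected on `s` only. -/
theorem sum_smul_sub_eq {d : ℕ} (b : OrthonormalBasis (Fin d) ℝ (EuclideanSpace ℝ (Fin d)))
    (s : Finset (Fin d)) (c : ℝ) (z w : Fin d → ℝ) :
    ‖(∑ j, z j • b j + ∑ j, w j • b j) -
        (c / ∑ k ∈ s, ⟪b k, ∑ j, z j • b j + ∑ j, w j • b j⟫ ^ 2) •
          (∑ k ∈ s, ⟪b k, ∑ j, z j • b j + ∑ j, w j • b j⟫ • b k) - ∑ j, z j • b j‖ ^ 2 =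
      ∑ j, (w j - if j ∈ s then c * ((z j + w j) / ∑ k ∈ s, (z k + w k) ^ 2) else 0) ^ 2 := by
  have hx (k : Fin d) : ⟪b k, ∑ j, z j • b j + ∑ j, w j • b j⟫ = z k + w k := by
    rw [inner_add_right, b.orthonormal.inner_right_fintype, b.orthonormal.inner_right_fintype]
  simp_rw [hx]
  generalize ∑ k ∈ s, (z k + w k) ^ 2 = q
  rw [← b.sum_sq_inner_right]
  refine Finset.sum_congr rfl fun k _ => ?_
  have hs : ∑ j ∈ s, (z j + w j) • b j = ∑ j, (if j ∈ s then z j + w j else 0) • b j := by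
    simp [ite_smul]
  rw [hs, inner_sub_right, inner_sub_right, hx, inner_smul_right,
    b.orthonormal.inner_right_fintype, b.orthonormal.inner_right_fintype]
  split_ifs <;> ring

/-- The integrated risk of an estimator shrinking along principal axes, as a Gaussian integral in
principal coordinates. -/
theorem integratedRisk_eq {n d : ℕ} (hn : n ≠ 0) (hd : 2 ≤ d) {ρ : ℝ}
    (h₀ : -1 / ((d : ℝ) - 1) < ρ) (h₁ : ρ < 1) {i₀ : Fin d}
    {b : OrthonormalBasis (Fin d) ℝ (EuclideanSpace ℝ (Fin d))}
    (hb : b i₀ = WithLp.toLp 2 fun _ => (Real.sqrt d)⁻¹) (s : Finset (Fin d)) (c : ℝ)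
    {est : (Fin n → Fin d → ℝ) → EuclideanSpace ℝ (Fin d)}
    (hest : ∀ Y, est Y = WithLp.toLp 2 (sampleMean Y) -
      (c / ∑ k ∈ s, ⟪b k, WithLp.toLp 2 (sampleMean Y)⟫ ^ 2) •
        (∑ k ∈ s, ⟪b k, WithLp.toLp 2 (sampleMean Y)⟫ • b k)) :
    integratedRisk est (multivariateGaussian 0 (compoundSymm d ρ)) =
      ∫⁻ p : (Fin d → ℝ) × (Fin d → ℝ), ENNReal.ofReal (∑ j, (p.2 j - if j ∈ s then
        c * ((p.1 j + p.2 j) / ∑ k ∈ s, (p.1 k + p.2 k) ^ 2) else 0) ^ 2)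
        ∂(gaussPi (axisVar i₀ ρ)).prod (gaussPi fun _ => (n : ℝ≥0)⁻¹) := by
  have hm : Measurable fun Y : Fin n → Fin d → ℝ => WithLp.toLp 2 (sampleMean Y) := by
    unfold sampleMean
    fun_prop
  have hF : Measurable fun p : EuclideanSpace ℝ (Fin d) × EuclideanSpace ℝ (Fin d) =>
      ENNReal.ofReal (‖p.2 - (c / ∑ k ∈ s, ⟪b k, p.2⟫ ^ 2) • (∑ k ∈ s, ⟪b k, p.2⟫ • b k) -
        p.1‖ ^ 2) := by fun_prop
  have hr (μ : EuclideanSpace ℝ (Fin d)) : risk est μ =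
      ∫⁻ w, ENNReal.ofReal (‖(μ + ∑ j, w j • b j) -
        (c / ∑ k ∈ s, ⟪b k, μ + ∑ j, w j • b j⟫ ^ 2) •
          (∑ k ∈ s, ⟪b k, μ + ∑ j, w j • b j⟫ • b k) - μ‖ ^ 2)
        ∂gaussPi fun _ => (n : ℝ≥0)⁻¹ := by
    have hFμ := hF.comp (measurable_prodMk_left (x := μ))
    have k₁ := lintegral_map (μ := dataLaw n μ) hFμ hm
    rw [map_dataLaw hn b, lintegral_map hFμ (by fun_prop)] at k₁
    simp only [Function.comp_def] at k₁
    simp only [risk, hest, k₁]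
  rw [integratedRisk, multivariateGaussian_compoundSymm hd h₀ h₁ hb]
  simp_rw [hr]
  rw [lintegral_map _ (by fun_prop), lintegral_prod]
  · simp_rw [sum_smul_sub_eq]
  · refine (ENNReal.measurable_ofReal.comp ?_).aemeasurable
    refine Finset.measurable_fun_sum _ fun j _ => ?_
    split_ifs <;> fun_prop
  · refine Measurable.lintegral_prod_right' (f := fun p : EuclideanSpace ℝ (Fin d) × (Fin d → ℝ) =>
      ENNReal.ofReal (‖(p.1 + ∑ j, p.2 j • b j) -
        (c / ∑ k ∈ s, ⟪b k, p.1 + ∑ j, p.2 j • b j⟫ ^ 2) •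
          (∑ k ∈ s, ⟪b k, p.1 + ∑ j, p.2 j • b j⟫ • b k) - p.1‖ ^ 2)) ?_
    fun_prop

end NormalMeans

end

/-! ### Evaluation of the Laplace integrals -/

theorem Real.sqrt_pow_eq {x : ℝ} (hx : 0 ≤ x) (k : ℕ) : √(x ^ k) = √x ^ k := by
  rw [Real.sqrt_eq_iff_mul_self_eq (by positivity) (by positivity), ← mul_pow,
    Real.mul_self_sqrt hx]

theorem lintegral_inv_sqrt_pow {v : ℝ} (hv : 0 < v) {m : ℕ} (hm : m ≠ 0) :
    ∫⁻ t in Set.Ioi 0, ENNReal.ofReal ((√(1 + 2 * t * v))⁻¹ ^ (m + 2)) =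
      ENNReal.ofReal (1 / (v * m)) := by
  have hm' : (m : ℝ) ≠ 0 := by exact_mod_cast hm
  -- An explicit antiderivative; it tends to 0 at infinity because `m ≠ 0`.
  have hd (t : ℝ) (ht : t ∈ Set.Ici (0 : ℝ)) :
      HasDerivAt (fun t => -(1 / (v * m)) * (√(1 + 2 * t * v))⁻¹ ^ m)
        ((√(1 + 2 * t * v))⁻¹ ^ (m + 2)) t := by
    have ht' : (0 : ℝ) ≤ t := ht
    have hp : 0 < 1 + 2 * t * v := by positivity
    have h₁ : HasDerivAt (fun t => 1 + 2 * t * v) (2 * v) t := by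
      simpa using (((hasDerivAt_id t).const_mul 2).mul_const v).const_add 1
    have hne : √(1 + 2 * t * v) ≠ 0 := by positivity
    convert! (((h₁.sqrt hp.ne').inv hne).pow m).const_mul (-(1 / (v * m))) using 1
    obtain ⟨k, rfl⟩ := Nat.exists_eq_succ_of_ne_zero hm
    simp only [Nat.succ_eq_add_one, add_tsub_cancel_right, Pi.inv_apply, inv_pow]
    field_simp
    ring
  have htop : Filter.Tendsto (fun t => -(1 / (v * m)) * (√(1 + 2 * t * v))⁻¹ ^ m)
      Filter.atTop (nhds 0) := by
    have h₁ : Filter.Tendsto (fun t : ℝ => 1 + 2 * t * v) Filter.atTop Filter.atTop :=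
      Filter.tendsto_atTop_add_const_left _ _
        ((Filter.tendsto_id.const_mul_atTop two_pos).atTop_mul_const hv)
    have h₂ := ((Real.tendsto_sqrt_atTop.comp h₁).inv_tendsto_atTop.pow m).const_mul (-(1 / (v * m)))
    simpa [hm] using h₂
  have hpos (t : ℝ) (_ : t ∈ Set.Ioi (0 : ℝ)) : 0 ≤ (√(1 + 2 * t * v))⁻¹ ^ (m + 2) := by
    positivity
  rw [← ofReal_integral_eq_lintegral_ofReal (integrableOn_Ioi_deriv_of_nonneg' hd hpos htop)
    (ae_of_all _ fun t => by positivity), integral_Ioi_of_hasDerivAt_of_nonneg' hd hpos htop]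
  simp

namespace NormalMeans

theorem xi_pos {n d : ℕ} {ρ : ℝ} (hα : 0 < 1 + ((d : ℝ) - 1) * ρ) (hβ : 0 < 1 - ρ) {u : ℝ}
    (hu : u ≤ 1) : 0 < xi n d ρ u := by
  have : 0 ≤ 1 - u := by linarith
  unfold xi
  positivity

theorem intervalIntegrable_xi {n d : ℕ} (hd : 4 ≤ d) {ρ : ℝ} (hα : 0 < 1 + ((d : ℝ) - 1) * ρ)
    (hβ : 0 < 1 - ρ) : IntervalIntegrable
      (fun u : ℝ => u ^ (((d : ℝ) - 2) / 2 - 1) / √(xi n d ρ u)) volume 0 1 := by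
  have hd' : (4 : ℝ) ≤ d := by exact_mod_cast hd
  refine ContinuousOn.intervalIntegrable ?_
  rw [Set.uIcc_of_le zero_le_one]
  refine ContinuousOn.div (continuous_id.rpow_const fun _ => Or.inr (by simp; linarith)).continuousOn
    ?_ fun u hu => (Real.sqrt_pos.2 (xi_pos hα hβ hu.2)).ne'
  unfold xi
  fun_prop

/-- Under `t = (n/2)(1/u - 1)` each `1 + 2t(α + 1/n)` becomes `(1 + nα(1-u))/u`. The `d` factors
`√u` and the Jacobian's `u⁻²` make up the power `d/2 - 2 = (d-2)/2 - 1`. -/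
theorem jacobian_mul_eq {n d : ℕ} (hn : n ≠ 0) (hd : 1 ≤ d) {ρ : ℝ}
    (hα : 0 < 1 + ((d : ℝ) - 1) * ρ) (hβ : 0 < 1 - ρ) {u : ℝ} (hu₀ : 0 < u) (hu₁ : u < 1) :
    n / 2 * (u ^ 2)⁻¹ *
        ((√(1 + 2 * (n / 2 * (u⁻¹ - 1)) * ((1 + ((d : ℝ) - 1) * ρ) + (n : ℝ)⁻¹)))⁻¹ *
          (√(1 + 2 * (n / 2 * (u⁻¹ - 1)) * ((1 - ρ) + (n : ℝ)⁻¹)))⁻¹ ^ (d - 1)) =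
      n / 2 * (u ^ (((d : ℝ) - 2) / 2 - 1) / √(xi n d ρ u)) := by
  have hn' : (n : ℝ) ≠ 0 := by exact_mod_cast hn
  have h1u : 0 ≤ 1 - u := by linarith
  have e (α : ℝ) : 1 + 2 * (n / 2 * (u⁻¹ - 1)) * (α + (n : ℝ)⁻¹) =
      (1 + n * α * (1 - u)) / u := by
    field_simp
    ring
  have hp : u ^ (((d : ℝ) - 2) / 2 - 1) = √u ^ d / u ^ 2 := by
    rw [Real.sqrt_eq_rpow, ← Real.rpow_natCast, ← Real.rpow_natCast, ← Real.rpow_mul hu₀.le,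
      ← Real.rpow_sub hu₀]
    congr 1
    push_cast
    ring
  rw [e, e, hp, xi, Real.sqrt_mul (by positivity), Real.sqrt_pow_eq (by positivity),
    Real.sqrt_div (by positivity), Real.sqrt_div (by positivity)]
  obtain ⟨k, rfl⟩ := Nat.exists_eq_add_of_le' hd
  have := Real.sqrt_pos.2 hu₀
  rw [add_tsub_cancel_right, inv_div, inv_div, div_pow, pow_succ]
  field_simp
  ring

theorem lintegral_compoundSymm_eq {n d : ℕ} (hn : n ≠ 0) (hd : 4 ≤ d) {ρ : ℝ}
    (hα : 0 < 1 + ((d : ℝ) - 1) * ρ) (hβ : 0 < 1 - ρ) :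
    ∫⁻ t in Set.Ioi (0 : ℝ), ENNReal.ofReal
        ((√(1 + 2 * t * ((1 + ((d : ℝ) - 1) * ρ) + (n : ℝ)⁻¹)))⁻¹ *
          (√(1 + 2 * t * ((1 - ρ) + (n : ℝ)⁻¹)))⁻¹ ^ (d - 1)) =
      ENNReal.ofReal (n / 2 *
        ∫ u in (0 : ℝ)..1, u ^ (((d : ℝ) - 2) / 2 - 1) / √(xi n d ρ u)) := by
  have hn' : (0 : ℝ) < n := by exact_mod_cast Nat.pos_of_ne_zero hn
  have himg : (fun u : ℝ => n / 2 * (u⁻¹ - 1)) '' Set.Ioo 0 1 = Set.Ioi 0 := by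
    ext t
    simp only [Set.mem_image, Set.mem_Ioo, Set.mem_Ioi]
    constructor
    · rintro ⟨u, ⟨h₀, h₁⟩, rfl⟩
      have := (one_lt_inv₀ h₀).2 h₁
      exact mul_pos (by positivity) (by linarith)
    · intro ht
      refine ⟨(1 + 2 * t / n)⁻¹, ⟨by positivity, inv_lt_one_of_one_lt₀ ?_⟩, ?_⟩
      · have : 0 < 2 * t / n := by positivity
        linarith
      · rw [inv_inv]
        field_simp
        ring
  have hder (u : ℝ) (hu : u ∈ Set.Ioo (0 : ℝ) 1) :
      HasDerivWithinAt (fun u : ℝ => n / 2 * (u⁻¹ - 1)) (n / 2 * -(u ^ 2)⁻¹) (Set.Ioo 0 1) u :=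
    (((hasDerivAt_inv hu.1.ne').sub_const 1).const_mul _).hasDerivWithinAt
  have hinj : Set.InjOn (fun u : ℝ => n / 2 * (u⁻¹ - 1)) (Set.Ioo 0 1) := by
    intro a _ b _ hab
    have h : (n : ℝ) / 2 ≠ 0 := by positivity
    simpa [h, sub_left_inj] using hab
  rw [← himg, lintegral_image_eq_lintegral_abs_deriv_mul measurableSet_Ioo hder hinj,
    ← intervalIntegral.integral_const_mul, intervalIntegral.integral_of_le zero_le_one,
    integral_Ioc_eq_integral_Ioo, ofReal_integral_eq_lintegral_ofReal]
  · refine setLIntegral_congr_fun measurableSet_Ioo fun u hu => ?_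
    rw [← ENNReal.ofReal_mul (abs_nonneg _), mul_neg, abs_neg, abs_of_nonneg (by positivity),
      jacobian_mul_eq hn (by lia) hα hβ hu.1 hu.2]
  · exact (((intervalIntegrable_iff_integrableOn_Ioc_of_le zero_le_one).1
      (intervalIntegrable_xi hd hα hβ)).mono_set Set.Ioo_subset_Ioc_self).const_mul _
  · refine (ae_restrict_mem measurableSet_Ioo).mono fun u hu => ?_
    have := hu.1.le
    simp only [Pi.zero_apply]
    positivity

end NormalMeans

/-! ### The two estimators and their risks -/

namespace NormalMeans

open scoped NNReal RealInnerProductSpace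

/-- The integrated risk of a James-Stein estimator shrinking along principal axes, in terms of
the inverse moment of the squared norm of the shrunk part. -/
theorem integratedRisk_shrinkage {n d : ℕ} (hn : n ≠ 0) (hd : 2 ≤ d) {ρ : ℝ}
    (h₀ : -1 / ((d : ℝ) - 1) < ρ) (h₁ : ρ < 1) {i₀ : Fin d}
    {b : OrthonormalBasis (Fin d) ℝ (EuclideanSpace ℝ (Fin d))}
    (hb : b i₀ = WithLp.toLp 2 fun _ => (Real.sqrt d)⁻¹) {s : Finset (Fin d)} (hs : 2 ≤ s.card)
    {est : (Fin n → Fin d → ℝ) → EuclideanSpace ℝ (Fin d)}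
    (hest : ∀ Y, est Y = WithLp.toLp 2 (sampleMean Y) -
      ((n : ℝ)⁻¹ * (s.card - 2) / ∑ k ∈ s, ⟪b k, WithLp.toLp 2 (sampleMean Y)⟫ ^ 2) •
        (∑ k ∈ s, ⟪b k, WithLp.toLp 2 (sampleMean Y)⟫ • b k)) {M : ℝ} (hM₀ : 0 ≤ M)
    (hM : ∫⁻ t in Set.Ioi 0, ENNReal.ofReal
      (∏ j ∈ s, (√(1 + 2 * t * (axisVar i₀ ρ j + (n : ℝ)⁻¹)))⁻¹) = ENNReal.ofReal M) :
    integratedRisk est (multivariateGaussian 0 (compoundSymm d ρ)) ≠ ⊤ ∧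
      (integratedRisk est (multivariateGaussian 0 (compoundSymm d ρ))).toReal =
        d / n - ((s.card : ℝ) - 2) ^ 2 / n ^ 2 * M := by
  have hτ : ((n : ℝ≥0)⁻¹) ≠ 0 := by
    have : (n : ℝ≥0) ≠ 0 := by exact_mod_cast hn
    positivity
  have hcoe : (((n : ℝ≥0)⁻¹ : ℝ≥0) : ℝ) = (n : ℝ)⁻¹ := by simp
  have hq := lintegral_inv_sum_sq (s := s) (Finset.card_pos.1 (by lia)) (axisVar i₀ ρ)
    (v := fun _ => (n : ℝ≥0)⁻¹) fun _ => hτ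
  rw [hcoe, hM] at hq
  have hnn (p : (Fin d → ℝ) × (Fin d → ℝ)) : 0 ≤ (∑ j ∈ s, (p.1 j + p.2 j) ^ 2)⁻¹ :=
    inv_nonneg.2 (Finset.sum_nonneg fun _ _ => sq_nonneg _)
  have hmeas : AEStronglyMeasurable (fun p : (Fin d → ℝ) × (Fin d → ℝ) =>
      (∑ j ∈ s, (p.1 j + p.2 j) ^ 2)⁻¹)
      ((gaussPi (axisVar i₀ ρ)).prod (gaussPi fun _ => (n : ℝ≥0)⁻¹)) :=
    Measurable.aestronglyMeasurable (by fun_prop)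
  -- Finiteness of the inverse moment, already computed in `[0, ∞]`, supplies the integrability
  -- required by Stein's computation.
  have hint : Integrable (fun p : (Fin d → ℝ) × (Fin d → ℝ) =>
      (∑ j ∈ s, (p.1 j + p.2 j) ^ 2)⁻¹)
      ((gaussPi (axisVar i₀ ρ)).prod (gaussPi fun _ => (n : ℝ≥0)⁻¹)) := by
    refine ⟨hmeas, ?_⟩
    rw [hasFiniteIntegral_iff_ofReal (ae_of_all _ hnn), hq]
    exact ENNReal.ofReal_lt_top
  have hval : ∫ p : (Fin d → ℝ) × (Fin d → ℝ), (∑ j ∈ s, (p.1 j + p.2 j) ^ 2)⁻¹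
      ∂(gaussPi (axisVar i₀ ρ)).prod (gaussPi fun _ => (n : ℝ≥0)⁻¹) = M := by
    rw [integral_eq_lintegral_of_nonneg_ae (ae_of_all _ hnn) hmeas, hq, ENNReal.toReal_ofReal hM₀]
  obtain ⟨i₁, i₂⟩ := integral_shrinkage_loss hint hτ (fun _ => rfl) hs
  rw [hcoe] at i₁ i₂
  have hpos : 0 ≤ᵐ[(gaussPi (axisVar i₀ ρ)).prod (gaussPi fun _ => (n : ℝ≥0)⁻¹)]
      fun p : (Fin d → ℝ) × (Fin d → ℝ) => ∑ j, (p.2 j - if j ∈ s then (n : ℝ)⁻¹ *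
        (s.card - 2) * ((p.1 j + p.2 j) / ∑ k ∈ s, (p.1 k + p.2 k) ^ 2) else 0) ^ 2 :=
    ae_of_all _ fun p => Finset.sum_nonneg fun _ _ => sq_nonneg _
  rw [integratedRisk_eq hn hd h₀ h₁ hb s _ hest, ← ofReal_integral_eq_lintegral_ofReal i₁ hpos]
  refine ⟨ENNReal.ofReal_ne_top, ?_⟩
  rw [ENNReal.toReal_ofReal (integral_nonneg_of_ae hpos), i₂, hval, Fintype.card_fin]
  ring

theorem estPHB_eq {n d : ℕ} (b : OrthonormalBasis (Fin d) ℝ (EuclideanSpace ℝ (Fin d)))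
    (Y : Fin n → Fin d → ℝ) : estPHB Y = WithLp.toLp 2 (sampleMean Y) -
      ((n : ℝ)⁻¹ * (((Finset.univ : Finset (Fin d)).card : ℝ) - 2) /
        ∑ k, ⟪b k, WithLp.toLp 2 (sampleMean Y)⟫ ^ 2) •
        (∑ k, ⟪b k, WithLp.toLp 2 (sampleMean Y)⟫ • b k) := by
  rw [b.sum_repr', b.sum_sq_inner_right, EuclideanSpace.real_norm_sq_eq]
  ext j
  simp only [estPHB, PiLp.sub_apply, PiLp.smul_apply, smul_eq_mul, Finset.card_univ,
    Fintype.card_fin]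
  rw [sub_mul, one_mul, mul_comm (n : ℝ), ← div_div, div_right_comm, inv_mul_eq_div]

/-- Removing the component along `b i₀` subtracts the grand mean from each coordinate. The remaining
`d - 1` directions account for the constant `d - 3`. -/
theorem estHB_eq {n d : ℕ} {i₀ : Fin d}
    {b : OrthonormalBasis (Fin d) ℝ (EuclideanSpace ℝ (Fin d))}
    (hb : b i₀ = WithLp.toLp 2 fun _ => (Real.sqrt d)⁻¹)
    (Y : Fin n → Fin d → ℝ) : estHB Y = WithLp.toLp 2 (sampleMean Y) -
      ((n : ℝ)⁻¹ * (((Finset.univ.erase i₀).card : ℝ) - 2) /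
        ∑ k ∈ Finset.univ.erase i₀, ⟪b k, WithLp.toLp 2 (sampleMean Y)⟫ ^ 2) •
        (∑ k ∈ Finset.univ.erase i₀, ⟪b k, WithLp.toLp 2 (sampleMean Y)⟫ • b k) := by
  have hd : (0 : ℝ) < d := by exact_mod_cast i₀.pos
  set x : EuclideanSpace ℝ (Fin d) := WithLp.toLp 2 (sampleMean Y) with hx
  have hproj (j : Fin d) : (∑ k ∈ Finset.univ.erase i₀, ⟪b k, x⟫ • b k) j =
      sampleMean Y j - grandMean Y := by
    have h := b.sum_repr' x
    rw [← Finset.add_sum_erase _ _ (Finset.mem_univ i₀)] at h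
    rw [eq_sub_of_add_eq' h, PiLp.sub_apply, PiLp.smul_apply, hb, inner_const, smul_eq_mul,
      grandMean]
    simp only [hx]
    rw [mul_right_comm, ← mul_inv, Real.mul_self_sqrt hd.le]
  have hsq : ∑ k ∈ Finset.univ.erase i₀, ⟪b k, x⟫ ^ 2 =
      ∑ k, (sampleMean Y k - grandMean Y) ^ 2 := by
    simp_rw [← hproj]
    rw [← EuclideanSpace.real_norm_sq_eq, ← b.sum_sq_inner_right,
      ← Finset.add_sum_erase _ _ (Finset.mem_univ i₀)]
    have e (i : Fin d) : ⟪b i, ∑ k ∈ Finset.univ.erase i₀, ⟪b k, x⟫ • b k⟫ =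
        if i ∈ Finset.univ.erase i₀ then ⟪b i, x⟫ else 0 := by
      simp_rw [inner_sum, inner_smul_right, b.inner_eq_ite]
      simp
    simp_rw [e]
    simp +contextual
  have hcard : ((Finset.univ.erase i₀).card : ℝ) - 2 = d - 3 := by
    rw [Finset.card_erase_of_mem (Finset.mem_univ i₀), Finset.card_univ, Fintype.card_fin,
      Nat.cast_pred i₀.pos]
    ring
  rw [hsq, hcard]
  ext j
  rw [PiLp.sub_apply, PiLp.smul_apply, hproj]
  simp only [estHB, hx, smul_eq_mul]
  rw [mul_comm (n : ℝ), ← div_div, div_right_comm, inv_mul_eq_div]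
  ring

end NormalMeans

theorem proposition1 (n d : ℕ) (hn : 1 ≤ n) (hd : 5 ≤ d) (ρ : ℝ)
    (hρ₀ : -1 / ((d : ℝ) - 1) < ρ) (hρ₁ : ρ < 1) :
    (NormalMeans.integratedRisk (n := n) (d := d) NormalMeans.estHB
        (multivariateGaussian 0 (NormalMeans.compoundSymm d ρ)) ≠ ⊤ ∧
      (NormalMeans.integratedRisk (n := n) (d := d) NormalMeans.estHB
        (multivariateGaussian 0 (NormalMeans.compoundSymm d ρ))).toReal =
        (d : ℝ) / n - ((d : ℝ) - 3) / n * (1 / (1 + (n : ℝ) * (1 - ρ)))) ∧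
    (NormalMeans.integratedRisk (n := n) (d := d) NormalMeans.estPHB
        (multivariateGaussian 0 (NormalMeans.compoundSymm d ρ)) ≠ ⊤ ∧
      IntervalIntegrable
        (fun u : ℝ => u ^ (((d : ℝ) - 2) / 2 - 1) / Real.sqrt (NormalMeans.xi n d ρ u))
        volume 0 1 ∧
      (NormalMeans.integratedRisk (n := n) (d := d) NormalMeans.estPHB
        (multivariateGaussian 0 (NormalMeans.compoundSymm d ρ))).toReal =
        (d : ℝ) / n - ((d : ℝ) - 2) ^ 2 / (2 * n) *
          ∫ u in (0 : ℝ)..1,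
            u ^ (((d : ℝ) - 2) / 2 - 1) / Real.sqrt (NormalMeans.xi n d ρ u)) := by
  have hn₀ : n ≠ 0 := by lia
  have hnpos : (0 : ℝ) < n := by exact_mod_cast hn
  have hd₅ : (5 : ℝ) ≤ d := by exact_mod_cast hd
  have hβ : 0 < 1 - ρ := by linarith
  have hα : 0 < 1 + ((d : ℝ) - 1) * ρ := by
    rw [div_lt_iff₀ (by linarith)] at hρ₀
    linarith
  let i₀ : Fin d := ⟨0, by lia⟩
  obtain ⟨b, hb⟩ := NormalMeans.exists_basis_eq_const i₀
  have hcard : (Finset.univ.erase i₀).card = d - 1 := by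
    rw [Finset.card_erase_of_mem (Finset.mem_univ i₀), Finset.card_univ, Fintype.card_fin]
  have haxis (t : ℝ) : ∏ j ∈ Finset.univ.erase i₀,
      (√(1 + 2 * t * (NormalMeans.axisVar i₀ ρ j + (n : ℝ)⁻¹)))⁻¹ =
        (√(1 + 2 * t * ((1 - ρ) + (n : ℝ)⁻¹)))⁻¹ ^ (d - 1) := by
    rw [← hcard]
    refine Finset.prod_eq_pow_card fun j hj => ?_
    rw [NormalMeans.axisVar, if_neg (Finset.ne_of_mem_erase hj), Real.coe_toNNReal _ hβ.le]
  refine ⟨?_, ?_⟩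
  · have hM : ∫⁻ t in Set.Ioi 0, ENNReal.ofReal (∏ j ∈ Finset.univ.erase i₀,
        (√(1 + 2 * t * (NormalMeans.axisVar i₀ ρ j + (n : ℝ)⁻¹)))⁻¹) =
        ENNReal.ofReal (1 / (((1 - ρ) + (n : ℝ)⁻¹) * (d - 3 : ℕ))) := by
      -- All `d - 1` remaining variances are equal, so the elementary integral applies with `m = d -
      -- 3`.
      simp_rw [haxis, show d - 1 = d - 3 + 2 by lia]
      exact lintegral_inv_sqrt_pow (by positivity) (by lia)
    obtain ⟨h₁, h₂⟩ := NormalMeans.integratedRisk_shrinkage hn₀ (by lia) hρ₀ hρ₁ hb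
      (by lia) (NormalMeans.estHB_eq hb) (by positivity) hM
    refine ⟨h₁, ?_⟩
    rw [h₂, hcard, Nat.cast_sub (by lia), Nat.cast_sub (by lia)]
    have : (d : ℝ) - 3 ≠ 0 := by linarith
    have h₃ : 1 + (n : ℝ) * (1 - ρ) ≠ 0 := by positivity
    have h₄ : (1 - ρ) + (n : ℝ)⁻¹ = (1 + (n : ℝ) * (1 - ρ)) / n := by
      field_simp
      ring
    rw [h₄]
    push_cast
    field_simp
    ring
  · have hM : ∫⁻ t in Set.Ioi 0, ENNReal.ofReal (∏ j,
        (√(1 + 2 * t * (NormalMeans.axisVar i₀ ρ j + (n : ℝ)⁻¹)))⁻¹) =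
        ENNReal.ofReal (n / 2 * ∫ u in (0 : ℝ)..1,
          u ^ (((d : ℝ) - 2) / 2 - 1) / √(NormalMeans.xi n d ρ u)) := by
      rw [← NormalMeans.lintegral_compoundSymm_eq hn₀ (by lia) hα hβ]
      congr with t
      -- The axis `i₀` is split off: its variance gives the first factor of `ξ`, and the others give
      -- the power `d - 1`.
      rw [← Finset.mul_prod_erase _ _ (Finset.mem_univ i₀), haxis, NormalMeans.axisVar,
        if_pos rfl, Real.coe_toNNReal _ hα.le]
    have hnonneg : 0 ≤ ∫ u in (0 : ℝ)..1,
        u ^ (((d : ℝ) - 2) / 2 - 1) / √(NormalMeans.xi n d ρ u) :=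
      intervalIntegral.integral_nonneg zero_le_one fun u hu =>
        div_nonneg (Real.rpow_nonneg hu.1 _) (Real.sqrt_nonneg _)
    obtain ⟨h₁, h₂⟩ := NormalMeans.integratedRisk_shrinkage hn₀ (by lia) hρ₀ hρ₁ hb
      (by rw [Finset.card_univ, Fintype.card_fin]; lia) (NormalMeans.estPHB_eq b)
      (by positivity) hM
    refine ⟨h₁, NormalMeans.intervalIntegrable_xi (by lia) hα hβ, ?_⟩
    rw [h₂, Finset.card_univ, Fintype.card_fin]
    field_simp
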